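/- Put $\psi(t)=\dfrac{1}{\log(e/t)}$ for $0<t<1$ and $\psi(t)=t$ for $t\ge 1$. Let $S(0,\infty)$ be the set of measurable functions $f$ on $(0,\infty)$ (with Lebesgue measure $m$) such that $m\{|f|>n\}<\infty$ for some $n\in\mathbb N$, let $\mu(s,f)=\inf\{r\ge 0:\ m\{|f|>r\}\le s\}$, $s>0$, be the decreasing rearrangement of $f\in S(0,\infty)$, and let $$\mathtt M_\psi(0,\infty)=\{f\in S(0,\infty):\ \|f\|_{\mathtt M_\psi}<\infty\},\qquad \|f\|_{\mathtt M_\psi}=\sup_{t>0}\frac1{\psi(t)}\int_0^t\mu(s,f)\,ds .$$ For $d\in\mathbb N$, $d\ge1$, let $r_d(t)=|t|^d$, $t\in\mathbb R^d$. For a function $g$ on $\mathbb R^d$ let $$\Big\|(1-\Delta)^{-\frac d4}M_g(1-\Delta)^{-\frac d4}\Big\|_\infty\in[0,\infty]$$ be the supremum of $\|(1-\Delta)^{-\frac d4}(g\cdot(1-\Delta)^{-\frac d4}x)\|_{L_2(\mathbb R^d)}$ over all $x\in L_2(\mathbb R^d)$ with $\|x\|_2\le1$. Here $(1-\Delta)^{-\frac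 d4}$ acts on tempered distributions, $M_g$ is multiplication by $g$, and the norm is $\infty$ if, for some such $x$, the product $g\cdot(1-\Delta)^{-\frac d4}x$ does not define a tempered distribution by integration against Schwartz functions, or the result is not in $L_2(\mathbb R^d)$. **Proposition.** For every $d\in\mathbb N$, $d\geq 1$, there is a constant $c_d>0$, depending only on $d$, such that for every $f\in\mathtt M_\psi(0,\infty)$ with $f=\mu(f)$ almost everywhere, $$\Big\|(1-\Delta)^{-\frac d4}M_{f\circ r_d}(1-\Delta)^{-\frac d4}\Big\|_\infty\ \ge\ c_d\,\|f\|_{\mathtt M_\psi}.$$ -/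

import Mathlib

open MeasureTheory Set
open scoped SchwartzMap ENNReal

noncomputable section

namespace Cwikel

/-- `S(Ω, ν)`: the measurable functions `f` such that, for some `n`, the function `|f| χ_{|f| > n}`
is supported on a set of finite measure. -/
def MemS {Ω : Type*} [MeasurableSpace Ω] (ν : Measure Ω) (f : Ω → ℝ) : Prop :=
  AEMeasurable f ν ∧ ∃ n : ℕ, ν {x | (n : ℝ) < |f x|} < ∞

/-- The decreasing rearrangement `μ(s, f) = inf {r ≥ 0 : ν {|f| > r} ≤ s}`, `s > 0`, of `f ∈ S(Ω, ν)`
(for such `f` and `s > 0` the set of admissible `r` is not empty). -/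
def rearrangement {Ω : Type*} [MeasurableSpace Ω] (ν : Measure Ω) (f : Ω → ℝ) (s : ℝ) : ℝ :=
  sInf {r : ℝ | 0 ≤ r ∧ ν {x | r < |f x|} ≤ ENNReal.ofReal s}

/-- `ψ(t) = 1 / log (e / t)` for `0 < t < 1` and `ψ(t) = t` for `t ≥ 1`. -/
def psi (t : ℝ) : ℝ :=
  if t < 1 then 1 / Real.log (Real.exp 1 / t) else t

/-- The Marcinkiewicz norm `‖f‖ = sup_{t > 0} ψ(t)⁻¹ ∫₀ᵗ μ(s, f) ds`, with values in `[0, ∞]`. -/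
def marcinkiewiczNorm {Ω : Type*} [MeasurableSpace Ω] (ν : Measure Ω) (f : Ω → ℝ) : ℝ≥0∞ :=
  ⨆ (t : ℝ) (_ : 0 < t),
    (∫⁻ s in Ioo 0 t, ENNReal.ofReal (rearrangement ν f s)) / ENNReal.ofReal (psi t)

/-- Membership in the Marcinkiewicz space `M_ψ(Ω, ν)`. -/
def MemMarcinkiewicz {Ω : Type*} [MeasurableSpace Ω] (ν : Measure Ω) (f : Ω → ℝ) : Prop :=
  MemS ν f ∧ marcinkiewiczNorm ν f < ∞

/-- Lebesgue measure on `(0, ∞)`. -/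
abbrev halfLine : Measure ℝ := volume.restrict (Ioi 0)

/-- `ℝ^d` with its Euclidean norm. -/
abbrev Rd (d : ℕ) : Type := EuclideanSpace ℝ (Fin d)

/-- Complex `L₂(ℝ^d)`. -/
abbrev L2 (d : ℕ) : Type := Lp ℂ 2 (volume : Measure (Rd d))

/-- `r_d(t) = |t|^d`. -/
def rd (d : ℕ) (t : Rd d) : ℝ := ‖t‖ ^ d

/-- `(1 - Δ)^s` on tempered distributions: the Fourier multiplier with the symbol
`ξ ↦ (1 + |2πξ|²)^s`. (In the normalisation of the Fourier transform used here, `-Δ` has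
the symbol `|2πξ|²`.) -/
def oneSubLaplacianPow (d : ℕ) (s : ℝ) : 𝓢'(Rd d, ℂ) →L[ℂ] 𝓢'(Rd d, ℂ) :=
  TemperedDistribution.fourierMultiplierCLM ℂ
    (fun ξ : Rd d ↦ (((1 + (2 * Real.pi * ‖ξ‖) ^ 2) ^ s : ℝ) : ℂ))

/-- The tempered distribution `V` is given by integration against the function `v`. -/
def IsGivenBy {d : ℕ} (V : 𝓢'(Rd d, ℂ)) (v : Rd d → ℂ) : Prop :=
  ∀ φ : 𝓢(Rd d, ℂ), Integrable (fun t ↦ φ t * v t) ∧ V φ = ∫ t, φ t * v t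

/-- `IsCwikelImage g x w` says `w = (1 - Δ)^(-d/4) M_g (1 - Δ)^(-d/4) x`, for `x, w ∈ L₂(ℝ^d)`:
the first factor sends `x` to some `u ∈ L₂(ℝ^d)`, the function `g · u` is a tempered distribution
`V`, and the last factor sends `V` to `w`. -/
def IsCwikelImage {d : ℕ} (g : Rd d → ℝ) (x w : L2 d) : Prop :=
  ∃ (u : L2 d) (V : 𝓢'(Rd d, ℂ)),
    oneSubLaplacianPow d (-(d / 4 : ℝ)) (Lp.toTemperedDistribution x) =
      Lp.toTemperedDistribution u ∧
    IsGivenBy V (fun t ↦ (g t : ℂ) * u t) ∧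
    oneSubLaplacianPow d (-(d / 4 : ℝ)) V = Lp.toTemperedDistribution w

/-- The uniform norm `sup_{‖x‖₂ ≤ 1} ‖(1 - Δ)^(-d/4) M_g (1 - Δ)^(-d/4) x‖₂ ∈ [0, ∞]` of the
symmetrized Cwikel operator on `L₂(ℝ^d)`. The element `w` below is unique if it exists; if some `x`
is not mapped into `L₂(ℝ^d)`, the infimum is over the empty set and the norm is `∞`. -/
def cwikelNorm {d : ℕ} (g : Rd d → ℝ) : ℝ≥0∞ :=
  ⨆ (x : L2 d) (_ : ‖x‖ ≤ 1), ⨅ (w : L2 d) (_ : IsCwikelImage g x w), ‖w‖ₑ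

end Cwikel

end

/-! For `g ≥ 0` the norm dominates the quadratic form `∫ g |U|²`, where `U = (1 - Δ)^(-d/4) x` and
`‖x‖₂ ≤ 1` (`lintegral_mul_enorm_sq_le_cwikelNorm`). It is enough to find, for each `τ > 0`, an
admissible `x` with `U` large on `|t|^d < τ`.

Let `φ` be a bump function at frequency scale `τ^(-1/d)`, let `A = ∫ φ(ξ) (1 + |2πξ|²)^(-d/2) dξ`,
and let `x` have Fourier transform `A^(-1/2) φ (1 + |2πξ|²)^(-d/4)`. Then `U` has a nonnegative
Fourier transform of integral `√A`, and the phases stay below `π/3` on `|t|^d < τ`, so `|U| ≥ √A /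
2` there. The symbol decays like `|ξ|^(-d)`, the borderline of integrability, so `A` is at least a
multiple of `log (1 + c/τ)` (`lintegral_le_cwikelNorm`).

Polar coordinates turn `∫ g` over `|t|^d < τ` into a multiple of `∫₀^τ f`, and `log (1 + 1/τ)`
dominates `1/ψ(τ)` up to a constant (`inv_psi_le_log`). The supremum over `τ` is the Marcinkiewicz
norm. -/

namespace Cwikel

open FourierTransform

variable {d : ℕ}

/-! ### Bessel potentials and the quadratic form -/

/-- The Fourier symbol of `(1 - Δ)^s`. -/
noncomputable def besselSymbol (d : ℕ) (s : ℝ) (ξ : Rd d) : ℝ :=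
  (1 + (2 * Real.pi * ‖ξ‖) ^ 2) ^ s

theorem hasTemperateGrowth_besselSymbol (s : ℝ) : (besselSymbol d s).HasTemperateGrowth := by
  have h := (Function.hasTemperateGrowth_one_add_norm_sq_rpow (Rd d) s).comp
    ((2 * Real.pi) • ContinuousLinearMap.id ℝ (Rd d)).hasTemperateGrowth
  refine (funext fun ξ ↦ ?_ : besselSymbol d s = _) ▸ h
  simp [besselSymbol, norm_smul, abs_of_pos Real.pi_pos]

theorem hasTemperateGrowth_ofReal_besselSymbol (s : ℝ) :
    (fun ξ : Rd d ↦ (besselSymbol d s ξ : ℂ)).HasTemperateGrowth :=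
  Function.HasTemperateGrowth.comp Function.Complex.hasTemperateGrowth_ofReal (hasTemperateGrowth_besselSymbol s)

theorem fourier_eq_fourierInv_of_even {h : 𝓢(Rd d, ℂ)} (heven : ∀ ξ, h (-ξ) = h ξ) :
    𝓕 h = 𝓕⁻ h := by
  ext y
  rw [SchwartzMap.fourierInv_coe, SchwartzMap.fourier_coe, Real.fourierInv_eq_fourier_comp_neg]
  simp_rw [heven]

/-- Real test functions make the bilinear pairing of distributions agree with the `L₂` inner
product. -/
theorem conj_fourierInv_of_even {h : 𝓢(Rd d, ℂ)} (heven : ∀ ξ, h (-ξ) = h ξ)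
    (hreal : ∀ ξ, (starRingEnd ℂ) (h ξ) = h ξ) (y : Rd d) :
    (starRingEnd ℂ) ((𝓕⁻ h) y) = (𝓕⁻ h) y := by
  nth_rw 2 [← fourier_eq_fourierInv_of_even heven]
  rw [SchwartzMap.fourierInv_coe, SchwartzMap.fourier_coe, Real.fourierInv_eq, Real.fourier_eq,
    ← integral_conj]
  congr 1
  ext v
  simp [Circle.smul_def, hreal, AddChar.map_neg_eq_inv]

theorem ae_eq_of_toTemperedDistribution_eq {u : L2 d} {U : 𝓢(Rd d, ℂ)}
    (h : Lp.toTemperedDistribution u = U.toTemperedDistributionCLM (Rd d) ℂ volume) :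
    u =ᵐ[volume] U := by
  have hinj : Function.Injective (Lp.toTemperedDistributionCLM ℂ (volume : Measure (Rd d)) 2) :=
    LinearMap.ker_eq_bot.mp Lp.ker_toTemperedDistributionCLM_eq_bot
  have : u = U.toLp 2 := hinj (by simp [h])
  rw [this]
  exact U.coeFn_toLp 2 volume

theorem oneSubLaplacianPow_apply (s : ℝ) (V : 𝓢'(Rd d, ℂ)) (X : 𝓢(Rd d, ℂ)) :
    oneSubLaplacianPow d s V X =
      V (𝓕 (SchwartzMap.smulLeftCLM ℂ (fun ξ ↦ (besselSymbol d s ξ : ℂ)) (𝓕⁻ X))) :=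
  rfl

theorem oneSubLaplacianPow_toTemperedDistributionCLM (s : ℝ) (X : 𝓢(Rd d, ℂ)) :
    oneSubLaplacianPow d s (X.toTemperedDistributionCLM (Rd d) ℂ volume) =
      (𝓕⁻ (SchwartzMap.smulLeftCLM ℂ (fun ξ ↦ (besselSymbol d s ξ : ℂ)) (𝓕 X)) :
        𝓢(Rd d, ℂ)).toTemperedDistributionCLM (Rd d) ℂ volume :=
  TemperedDistribution.fourierMultiplierCLM_toTemperedDistributionCLM_eq
    (hasTemperateGrowth_ofReal_besselSymbol s) X

theorem integral_mul_eq_inner_toLp {X : 𝓢(Rd d, ℂ)}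
    (hXreal : ∀ t, (starRingEnd ℂ) (X t) = X t) (w : L2 d) :
    ∫ t, X t * w t = inner ℂ (X.toLp 2 : L2 d) w := by
  rw [L2.inner_def]
  apply integral_congr_ae
  filter_upwards [X.coeFn_toLp 2 volume] with t ht
  rw [ht, RCLike.inner_apply, hXreal, mul_comm]

theorem norm_integral_mul_le {X : 𝓢(Rd d, ℂ)} (hXreal : ∀ t, (starRingEnd ℂ) (X t) = X t)
    (hXnorm : ‖X.toLp 2‖ ≤ 1) (w : L2 d) : ‖∫ t, X t * w t‖ ≤ ‖w‖ := by
  rw [integral_mul_eq_inner_toLp hXreal]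
  exact (norm_inner_le_norm _ _).trans (mul_le_of_le_one_left (norm_nonneg w) hXnorm)

theorem mul_mul_ae_eq_ofReal {g : Rd d → ℝ} {U : 𝓢(Rd d, ℂ)}
    (hUreal : ∀ t, (starRingEnd ℂ) (U t) = U t) {u : L2 d} (hu : u =ᵐ[volume] U) :
    (fun t ↦ U t * ((g t : ℂ) * u t)) =ᵐ[volume] fun t ↦ ((g t * ‖U t‖ ^ 2 : ℝ) : ℂ) := by
  filter_upwards [hu] with t ht
  have := Complex.mul_conj' (U t)
  rw [hUreal] at this
  rw [ht]
  push_cast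
  rw [← this]
  ring

/-- Testing `V` on `U` itself supplies the integrability of `g |U|²`, so no growth condition on `g`
is needed. -/
theorem lintegral_form_le_enorm {g : Rd d → ℝ} (hg : ∀ᵐ t, 0 ≤ g t) {U : 𝓢(Rd d, ℂ)}
    (hUreal : ∀ t, (starRingEnd ℂ) (U t) = U t) {u : L2 d} (hu : u =ᵐ[volume] U)
    {V : 𝓢'(Rd d, ℂ)} (hV : IsGivenBy V (fun t ↦ (g t : ℂ) * u t)) :
    ∫⁻ t, ENNReal.ofReal (g t * ‖U t‖ ^ 2) ≤ ‖V U‖ₑ := by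
  have hae := mul_mul_ae_eq_ofReal (g := g) hUreal hu
  have hint : Integrable fun t ↦ g t * ‖U t‖ ^ 2 := by
    exact_mod_cast ((hV U).1.congr hae).re
  have hnn : 0 ≤ᵐ[volume] fun t ↦ g t * ‖U t‖ ^ 2 := by
    filter_upwards [hg] with t ht
    exact mul_nonneg ht (sq_nonneg _)
  rw [← ofReal_integral_eq_lintegral_ofReal hint hnn, (hV U).2, integral_congr_ae hae,
    integral_complex_ofReal, ← ofReal_norm, Complex.norm_real]
  exact ENNReal.ofReal_le_ofReal (le_abs_self _)

/-- If `x` has no image, the infimum is `∞` and the hypothesis holds vacuously. -/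
theorem le_cwikelNorm {g : Rd d → ℝ} {x : L2 d} (hx : ‖x‖ ≤ 1) {a : ℝ≥0∞}
    (h : ∀ w, IsCwikelImage g x w → a ≤ ‖w‖ₑ) : a ≤ cwikelNorm g := by
  unfold cwikelNorm
  exact le_iSup_of_le x (le_iSup_of_le hx (le_iInf fun w ↦ le_iInf fun hw ↦ h w hw))

/-- The quadratic form of the Cwikel operator, evaluated at functions with a real and even Fourier
transform, is bounded by the norm. -/
theorem lintegral_mul_enorm_sq_le_cwikelNorm {g : Rd d → ℝ} (hg : ∀ᵐ t, 0 ≤ g t)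
    {h k : 𝓢(Rd d, ℂ)} (heven : ∀ ξ, h (-ξ) = h ξ) (hreal : ∀ ξ, (starRingEnd ℂ) (h ξ) = h ξ)
    (hnorm : ‖h.toLp 2‖ ≤ 1)
    (hk : ∀ ξ, k ξ = (besselSymbol d (-(d / 4 : ℝ)) ξ : ℂ) * h ξ) :
    ∫⁻ t, ENNReal.ofReal (g t * ‖(𝓕⁻ k : 𝓢(Rd d, ℂ)) t‖ ^ 2) ≤ cwikelNorm g := by
  have hksmul : SchwartzMap.smulLeftCLM ℂ
      (fun ξ ↦ (besselSymbol d (-(d / 4 : ℝ)) ξ : ℂ)) h = k := by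
    ext ξ
    rw [SchwartzMap.smulLeftCLM_apply_apply (hasTemperateGrowth_ofReal_besselSymbol _), hk,
      smul_eq_mul]
  have hkeven (ξ) : k (-ξ) = k ξ := by simp [hk, heven, besselSymbol]
  have hkreal (ξ) : (starRingEnd ℂ) (k ξ) = k ξ := by simp [hk, hreal]
  have hXF : 𝓕⁻ h = 𝓕 h := (fourier_eq_fourierInv_of_even heven).symm
  have hUF : 𝓕⁻ k = 𝓕 k := (fourier_eq_fourierInv_of_even hkeven).symm
  have hXnorm : ‖(𝓕⁻ h : 𝓢(Rd d, ℂ)).toLp 2‖ ≤ 1 := by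
    rwa [hXF, SchwartzMap.norm_fourier_toL2_eq]
  refine le_cwikelNorm hXnorm fun w hw ↦ ?_
  obtain ⟨u, V, hu, hV, hVw⟩ := hw
  refine (lintegral_form_le_enorm hg (conj_fourierInv_of_even hkeven hkreal) (u := u) ?_ hV).trans ?_
  · apply ae_eq_of_toTemperedDistribution_eq
    rw [← hu, Lp.toTemperedDistribution_toLp_eq, oneSubLaplacianPow_toTemperedDistributionCLM,
      fourier_fourierInv_eq, hksmul]
  · have h1 := congrArg (fun T : 𝓢'(Rd d, ℂ) ↦ T (𝓕⁻ h : 𝓢(Rd d, ℂ))) hVw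
    simp only [Lp.toTemperedDistribution_apply, smul_eq_mul, oneSubLaplacianPow_apply] at h1
    -- The multiplier acts on test functions by `𝓕 ∘ m ∘ 𝓕⁻`. Since `h` is even, `𝓕⁻ h` may be read
    -- as `𝓕 h`, which cancels the inner `𝓕⁻` and leaves `V` tested on `𝓕 k = 𝓕⁻ k`.
    nth_rw 1 [hXF] at h1
    rw [fourierInv_fourier_eq, hksmul, ← hUF] at h1
    rw [h1, ← ofReal_norm, ← ofReal_norm]
    exact ENNReal.ofReal_le_ofReal
      (norm_integral_mul_le (conj_fourierInv_of_even heven hreal) hXnorm w)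

/-! ### Polar coordinates -/

theorem measurable_rd : Measurable (rd d) := by
  unfold rd
  fun_prop

theorem volume_rd_preimage_Iic (hd : 1 ≤ d) (b : ℝ) :
    volume (rd d ⁻¹' Iic b) = volume (Metric.ball (0 : Rd d) 1) * ENNReal.ofReal b := by
  rcases lt_or_ge b 0 with hb | hb
  · have : rd d ⁻¹' Iic b = ∅ := by
      ext x
      have : 0 ≤ ‖x‖ ^ d := by positivity
      simp only [rd, mem_preimage, mem_Iic, mem_empty_iff_false, iff_false]
      linarith
    rw [this, ENNReal.ofReal_of_nonpos hb.le]
    simp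
  · have hd0 : d ≠ 0 := by omega
    have hr : 0 ≤ b ^ (d : ℝ)⁻¹ := by positivity
    have hrb : (b ^ (d : ℝ)⁻¹) ^ d = b := Real.rpow_inv_natCast_pow hb hd0
    have : rd d ⁻¹' Iic b = Metric.closedBall 0 (b ^ (d : ℝ)⁻¹) := by
      ext x
      simp only [rd, mem_preimage, mem_Iic, Metric.mem_closedBall, dist_zero_right]
      conv_lhs => rw [← hrb]
      exact pow_le_pow_iff_left₀ (norm_nonneg x) hr hd0
    rw [this, Measure.addHaar_closedBall _ _ hr, finrank_euclideanSpace_fin, hrb, mul_comm]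

/-- Polar coordinates for functions of `|t|^d`. -/
theorem map_rd_volume (hd : 1 ≤ d) :
    (volume : Measure (Rd d)).map (rd d) = volume (Metric.ball (0 : Rd d) 1) • halfLine := by
  have hball : volume (Metric.ball (0 : Rd d) 1) ≠ ∞ := measure_ball_lt_top.ne
  have hIic (b : ℝ) : (volume : Measure (Rd d)).map (rd d) (Iic b) =
      volume (Metric.ball (0 : Rd d) 1) * ENNReal.ofReal b := by
    rw [Measure.map_apply measurable_rd measurableSet_Iic, volume_rd_preimage_Iic hd]
  have hne (b : ℝ) : (volume : Measure (Rd d)).map (rd d) (Iic b) ≠ ∞ := by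
    rw [hIic]
    exact ENNReal.mul_ne_top hball ENNReal.ofReal_ne_top
  refine Measure.ext_of_Ioc' _ _ (fun a b _ ↦ measure_ne_top_of_subset Ioc_subset_Iic_self (hne b))
    fun a b hab ↦ ?_
  have hdiff : Ioc a b = Iic b \ Iic a := by ext; simp [and_comm]
  have hinter : Ioc a b ∩ Ioi 0 = Ioc (max a 0) b := by
    ext x; simp only [mem_inter_iff, mem_Ioc, mem_Ioi, max_lt_iff]; tauto
  rw [Measure.smul_apply, Measure.restrict_apply measurableSet_Ioc, hinter, Real.volume_Ioc,
    smul_eq_mul, hdiff, measure_sdiff (Iic_subset_Iic.2 hab.le) measurableSet_Iic.nullMeasurableSet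
    (hne a), hIic, hIic, ← ENNReal.mul_sub (fun _ _ ↦ hball)]
  congr 1
  rcases le_total a 0 with ha | ha
  · simp [ENNReal.ofReal_of_nonpos ha, max_eq_right ha]
  · rw [max_eq_left ha, ENNReal.ofReal_sub _ ha]

theorem quasiMeasurePreserving_rd (hd : 1 ≤ d) :
    Measure.QuasiMeasurePreserving (rd d) volume halfLine :=
  ⟨measurable_rd, by
    rw [map_rd_volume hd]
    exact Measure.smul_absolutelyContinuous⟩

theorem lintegral_comp_rd (hd : 1 ≤ d) {F : ℝ → ℝ≥0∞} (hF : AEMeasurable F halfLine) (τ : ℝ) :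
    ∫⁻ t in rd d ⁻¹' Iio τ, F (rd d t) =
      volume (Metric.ball (0 : Rd d) 1) * ∫⁻ s in Ioo 0 τ, F s := by
  have hF' : AEMeasurable F ((volume : Measure (Rd d)).map (rd d)) := by
    rw [map_rd_volume hd]
    exact hF.smul_measure _
  rw [← lintegral_map' (μ := volume.restrict (rd d ⁻¹' Iio τ))
    (by rw [← Measure.restrict_map measurable_rd measurableSet_Iio]; exact hF'.restrict)
    measurable_rd.aemeasurable, ← Measure.restrict_map measurable_rd measurableSet_Iio,
    map_rd_volume hd, Measure.restrict_smul, lintegral_smul_measure, smul_eq_mul,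
    Measure.restrict_restrict measurableSet_Iio]
  congr 3
  ext x
  simp [and_comm]

/-! ### Test functions and the capacity bound -/

theorem besselSymbol_nonneg (s : ℝ) (ξ : Rd d) : 0 ≤ besselSymbol d s ξ := by
  unfold besselSymbol
  positivity

theorem besselSymbol_mul (s r : ℝ) (ξ : Rd d) :
    besselSymbol d s ξ * besselSymbol d r ξ = besselSymbol d (s + r) ξ := by
  unfold besselSymbol
  rw [Real.rpow_add (by positivity)]

theorem contDiff_besselSymbol (s : ℝ) : ContDiff ℝ (⊤ : ℕ∞) (besselSymbol d s) :=
  (hasTemperateGrowth_besselSymbol s).1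

/-- The Schwartz function `c φ (1 + |2πξ|²)^s` for a bump function `φ`. -/
noncomputable def cutoffSymbol (φ : ContDiffBump (0 : Rd d)) (c s : ℝ) : 𝓢(Rd d, ℂ) :=
  HasCompactSupport.toSchwartzMap (f := fun ξ ↦ ((c * (φ ξ * besselSymbol d s ξ) : ℝ) : ℂ))
    (by
      have h : HasCompactSupport fun ξ ↦ c * (φ ξ * besselSymbol d s ξ) :=
        (φ.hasCompactSupport.mul_right (f' := besselSymbol d s)).mul_left (f := fun _ ↦ c)
      exact h.comp_left (g := Complex.ofReal) Complex.ofReal_zero)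
    (Complex.ofRealCLM.contDiff.comp
      (contDiff_const.mul (φ.contDiff.mul (contDiff_besselSymbol s))))

@[simp]
theorem cutoffSymbol_apply (φ : ContDiffBump (0 : Rd d)) (c s : ℝ) (ξ : Rd d) :
    cutoffSymbol φ c s ξ = ((c * (φ ξ * besselSymbol d s ξ) : ℝ) : ℂ) :=
  rfl

theorem integrable_bump_mul_besselSymbol (φ : ContDiffBump (0 : Rd d)) (s : ℝ) :
    Integrable fun ξ ↦ φ ξ * besselSymbol d s ξ := by
  refine Continuous.integrable_of_hasCompactSupport
    (φ.continuous.mul (contDiff_besselSymbol s).continuous) ?_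
  exact φ.hasCompactSupport.mul_right

theorem norm_toLp_cutoffSymbol_le (φ : ContDiffBump (0 : Rd d)) {c s : ℝ}
    (h : c ^ 2 * ∫ ξ, φ ξ * besselSymbol d (s + s) ξ ≤ 1) :
    ‖(cutoffSymbol φ c s).toLp 2‖ ≤ 1 := by
  rw [SchwartzMap.norm_toLp' (by norm_num) (by norm_num)]
  refine Real.rpow_le_one (by positivity) ?_ (by positivity)
  refine le_trans ?_ h
  rw [← integral_const_mul]
  refine integral_mono_of_nonneg (ae_of_all _ fun ξ ↦ by positivity)
    ((integrable_bump_mul_besselSymbol φ (s + s)).const_mul _) (ae_of_all _ fun ξ ↦ ?_)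
  simp only [cutoffSymbol_apply, Complex.norm_real, ENNReal.toReal_ofNat, Real.rpow_two,
    Real.norm_eq_abs, sq_abs]
  rw [← besselSymbol_mul, mul_pow, mul_pow]
  -- As `0 ≤ φ ≤ 1`, replacing `φ²` by `φ` bounds the norm by the same integral that measures the
  -- size of `U`.
  have h1 : φ ξ ^ 2 ≤ φ ξ := by nlinarith [φ.nonneg (x := ξ), φ.le_one (x := ξ)]
  have h2 := mul_le_mul_of_nonneg_right h1 (sq_nonneg (besselSymbol d s ξ))
  nlinarith [mul_le_mul_of_nonneg_left h2 (sq_nonneg c)]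

/-- A function with a nonnegative Fourier transform is large where the phase is small. -/
theorem half_integral_le_norm_fourierInv {k : 𝓢(Rd d, ℂ)} {κ : Rd d → ℝ}
    (hk : ∀ ξ, k ξ = (κ ξ : ℂ)) (hκ : ∀ ξ, 0 ≤ κ ξ) (hint : Integrable κ) {y : Rd d}
    (hphase : ∀ ξ, κ ξ ≠ 0 → 2 * Real.pi * (‖ξ‖ * ‖y‖) ≤ Real.pi / 3) :
    1 / 2 * ∫ ξ, κ ξ ≤ ‖(𝓕⁻ k : 𝓢(Rd d, ℂ)) y‖ := by
  refine le_trans ?_ (Complex.re_le_norm _)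
  rw [SchwartzMap.fourierInv_coe, Real.fourierInv_eq']
  have hbase : Integrable fun v : Rd d ↦
      Complex.exp (((2 * Real.pi * inner ℝ v y : ℝ) : ℂ) * Complex.I) • k v := by
    refine k.integrable.bdd_mul (c := 1) (by fun_prop) (ae_of_all _ fun v ↦ ?_)
    rw [Complex.norm_exp_ofReal_mul_I]
  have hre : (∫ v : Rd d, Complex.exp (((2 * Real.pi * inner ℝ v y : ℝ) : ℂ) * Complex.I) • k v).re
      = ∫ v : Rd d, Real.cos (2 * Real.pi * inner ℝ v y) * κ v := by
    have := integral_re hbase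
    simp only [RCLike.re_to_complex] at this
    rw [← this]
    congr 1
    ext v
    rw [hk, smul_eq_mul, Complex.re_mul_ofReal, Complex.exp_ofReal_mul_I_re]
  rw [hre, ← integral_const_mul]
  have hint' : Integrable fun v : Rd d ↦ Real.cos (2 * Real.pi * inner ℝ v y) * κ v := by
    refine hint.bdd_mul (c := 1) (by fun_prop) (ae_of_all _ fun v ↦ ?_)
    exact Real.abs_cos_le_one _
  refine integral_mono (hint.const_mul _) hint' fun v ↦ ?_
  by_cases hv : κ v = 0
  · simp [hv]
  · refine mul_le_mul_of_nonneg_right ?_ (hκ v)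
    rw [← Real.cos_pi_div_three, ← Real.cos_abs (2 * Real.pi * inner ℝ v y)]
    refine Real.cos_le_cos_of_nonneg_of_le_pi (abs_nonneg _) (by linarith [Real.pi_pos]) ?_
    rw [abs_mul, abs_of_pos Real.two_pi_pos]
    exact (mul_le_mul_of_nonneg_left (abs_real_inner_le_norm v y) Real.two_pi_pos.le).trans
      (hphase v hv)

theorem inv_one_add_rd_le_besselSymbol (ξ : Rd d) :
    (8 ^ d)⁻¹ * (1 + rd d ξ)⁻¹ ≤ besselSymbol d (-(d / 2 : ℝ)) ξ := by
  have hx := norm_nonneg ξ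
  have hpi : Real.pi < 3.15 := Real.pi_lt_d2
  have hpos : 0 < 1 + (2 * Real.pi * ‖ξ‖) ^ 2 := by positivity
  -- With `M = max 1 ‖ξ‖`, `2π < 7` gives `1 + 49 M² ≤ 64 M²`, whence the constant `8`.
  have h1 : 1 + (2 * Real.pi * ‖ξ‖) ^ 2 ≤ (8 * max 1 ‖ξ‖) ^ 2 := by
    have h2 : 2 * Real.pi * ‖ξ‖ ≤ 7 * max 1 ‖ξ‖ := by
      have := le_max_right 1 ‖ξ‖
      have : 2 * Real.pi * ‖ξ‖ ≤ 7 * ‖ξ‖ := by gcongr; linarith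
      linarith
    have h3 : 1 ≤ max 1 ‖ξ‖ := le_max_left _ _
    have h4 : (2 * Real.pi * ‖ξ‖) ^ 2 ≤ (7 * max 1 ‖ξ‖) ^ 2 :=
      pow_le_pow_left₀ (by positivity) h2 2
    nlinarith
  have hmax : (max 1 ‖ξ‖) ^ d ≤ 1 + rd d ξ := by
    unfold rd
    rcases max_cases 1 ‖ξ‖ with ⟨h, -⟩ | ⟨h, -⟩ <;> rw [h]
    · rw [one_pow]; linarith [pow_nonneg hx d]
    · linarith
  have h5 : (1 + (2 * Real.pi * ‖ξ‖) ^ 2) ^ (d / 2 : ℝ) ≤ 8 ^ d * (1 + rd d ξ) := by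
    calc (1 + (2 * Real.pi * ‖ξ‖) ^ 2) ^ (d / 2 : ℝ)
        ≤ ((8 * max 1 ‖ξ‖) ^ 2) ^ (d / 2 : ℝ) :=
          Real.rpow_le_rpow hpos.le h1 (by positivity)
      _ = (8 * max 1 ‖ξ‖) ^ d := by
          rw [← Real.rpow_natCast _ 2, ← Real.rpow_mul (by positivity), ← Real.rpow_natCast _ d]
          congr 1
          push_cast
          ring
      _ ≤ 8 ^ d * (1 + rd d ξ) := by rw [mul_pow]; gcongr
  unfold besselSymbol
  rw [Real.rpow_neg hpos.le, ← mul_inv]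
  exact inv_anti₀ (by positivity) h5

theorem lintegral_inv_one_add {b : ℝ} (hb : 0 ≤ b) :
    ∫⁻ s in Ioo 0 b, ENNReal.ofReal (1 + s)⁻¹ = ENNReal.ofReal (Real.log (1 + b)) := by
  have hcont : ContinuousOn (fun s : ℝ ↦ (1 + s)⁻¹) (Icc 0 b) :=
    ContinuousOn.inv₀ (by fun_prop) fun s hs ↦ by linarith [hs.1]
  rw [← ofReal_integral_eq_lintegral_ofReal
    (hcont.integrableOn_Icc.mono_set Ioo_subset_Icc_self)
    ((ae_restrict_iff' measurableSet_Ioo).2 (ae_of_all _ fun s hs ↦ by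
      have := hs.1
      simp only [Pi.zero_apply]
      positivity)),
    ← integral_Ioc_eq_integral_Ioo, ← intervalIntegral.integral_of_le hb,
    intervalIntegral.integral_comp_add_left (fun s ↦ s⁻¹) 1, add_zero,
    integral_inv_of_pos one_pos (by linarith), div_one]

theorem log_le_integral_bump (hd : 1 ≤ d) (φ : ContDiffBump (0 : Rd d)) :
    (volume (Metric.ball (0 : Rd d) 1)).toReal * ((8 ^ d)⁻¹ * Real.log (1 + φ.rIn ^ d)) ≤
      ∫ ξ, φ ξ * besselSymbol d (-(d / 2 : ℝ)) ξ := by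
  have hball : volume (Metric.ball (0 : Rd d) 1) ≠ ∞ := measure_ball_lt_top.ne
  have hnn (ξ : Rd d) : 0 ≤ φ ξ * besselSymbol d (-(d / 2 : ℝ)) ξ :=
    mul_nonneg φ.nonneg (besselSymbol_nonneg _ _)
  have hR := φ.rIn_pos
  rw [← ENNReal.ofReal_le_ofReal_iff (integral_nonneg hnn),
    ofReal_integral_eq_lintegral_ofReal (integrable_bump_mul_besselSymbol φ _) (ae_of_all _ hnn),
    ENNReal.ofReal_mul ENNReal.toReal_nonneg, ENNReal.ofReal_toReal hball,
    ENNReal.ofReal_mul (by positivity), ← lintegral_inv_one_add (by positivity),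
    ← lintegral_const_mul _ (by fun_prop), ← lintegral_comp_rd hd (by fun_prop)]
  refine le_trans (setLIntegral_mono' (measurable_rd measurableSet_Iio) fun ξ hξ ↦ ?_)
    (setLIntegral_le_lintegral (rd d ⁻¹' Iio (φ.rIn ^ d)) _)
  rw [← ENNReal.ofReal_mul (by positivity)]
  apply ENNReal.ofReal_le_ofReal
  have hξ' : ‖ξ‖ < φ.rIn := lt_of_pow_lt_pow_left₀ d hR.le hξ
  rw [φ.one_of_mem_closedBall (by simpa using hξ'.le), one_mul]
  exact inv_one_add_rd_le_besselSymbol ξ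

/-- A lower bound for the capacity of the set `|t|^d < τ`. -/
theorem lintegral_le_cwikelNorm (hd : 1 ≤ d) {g : Rd d → ℝ} (hg : ∀ᵐ t, 0 ≤ g t) {τ : ℝ}
    (hτ : 0 < τ) :
    ENNReal.ofReal ((volume (Metric.ball (0 : Rd d) 1)).toReal *
        ((8 ^ d)⁻¹ * Real.log (1 + (12 ^ d)⁻¹ * τ⁻¹)) / 4) *
      ∫⁻ t in rd d ⁻¹' Iio τ, ENNReal.ofReal (g t) ≤ cwikelNorm g := by
  have hd0 : d ≠ 0 := by omega
  set r : ℝ := τ ^ (d : ℝ)⁻¹ with hr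
  have hrpos : 0 < r := by positivity
  have hrd : r ^ d = τ := Real.rpow_inv_natCast_pow hτ.le hd0
  -- The outer radius is `1/(6r)`, so `2π ‖ξ‖ ‖t‖ ≤ π/3` on the support whenever `‖t‖ < r`.
  let φ : ContDiffBump (0 : Rd d) := ⟨(12 * r)⁻¹, 2 * (12 * r)⁻¹, by positivity, by
    have : 0 < (12 * r)⁻¹ := by positivity
    linarith⟩
  set A : ℝ := ∫ ξ, φ ξ * besselSymbol d (-(d / 2 : ℝ)) ξ with hA
  have hAlow := log_le_integral_bump hd φ
  have hφd : φ.rIn ^ d = (12 ^ d)⁻¹ * τ⁻¹ := by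
    change ((12 * r)⁻¹) ^ d = _
    rw [inv_pow, mul_pow, hrd, mul_inv]
  rw [hφd, ← hA] at hAlow
  have hωpos : 0 < (volume (Metric.ball (0 : Rd d) 1)).toReal :=
    ENNReal.toReal_pos (Metric.measure_ball_pos _ _ one_pos).ne' measure_ball_lt_top.ne
  have hApos : 0 < A := by
    refine lt_of_lt_of_le ?_ hAlow
    have : 0 < Real.log (1 + (12 ^ d)⁻¹ * τ⁻¹) :=
      Real.log_pos (lt_add_of_pos_right _ (by positivity))
    positivity
  have hsqrt : 0 < √A := Real.sqrt_pos.2 hApos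
  have hsq : √A ^ 2 = A := Real.sq_sqrt hApos.le
  have hsum (r : ℝ) : -(r / 4) + -(r / 4) = -(r / 2) := by ring
  have hform := lintegral_mul_enorm_sq_le_cwikelNorm hg
    (h := cutoffSymbol φ (√A)⁻¹ (-(d / 4 : ℝ))) (k := cutoffSymbol φ (√A)⁻¹ (-(d / 2 : ℝ)))
    (fun ξ ↦ by simp [besselSymbol, φ.neg]) (fun ξ ↦ by rw [cutoffSymbol_apply, Complex.conj_ofReal])
    (norm_toLp_cutoffSymbol_le φ (by
      rw [hsum, ← hA, inv_pow, hsq, inv_mul_cancel₀ hApos.ne']))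
    (fun ξ ↦ by
      rw [cutoffSymbol_apply, cutoffSymbol_apply, ← hsum, ← besselSymbol_mul]
      push_cast
      ring)
  refine le_trans ?_ hform
  rw [← lintegral_const_mul' _ _ ENNReal.ofReal_ne_top]
  refine le_trans ?_ (setLIntegral_le_lintegral (rd d ⁻¹' Iio τ) _)
  refine lintegral_mono_ae ?_
  filter_upwards [ae_restrict_mem (measurable_rd measurableSet_Iio), ae_restrict_of_ae hg]
    with t ht hgt
  rw [← ENNReal.ofReal_mul (by
    have : 0 ≤ Real.log (1 + (12 ^ d)⁻¹ * τ⁻¹) :=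
      Real.log_nonneg (le_add_of_nonneg_right (by positivity))
    positivity), mul_comm]
  apply ENNReal.ofReal_le_ofReal
  refine mul_le_mul_of_nonneg_left ?_ hgt
  have htr : ‖t‖ < r := by
    apply lt_of_pow_lt_pow_left₀ d hrpos.le
    rw [hrd]
    exact ht
  have hlow := half_integral_le_norm_fourierInv (k := cutoffSymbol φ (√A)⁻¹ (-(d / 2 : ℝ)))
    (cutoffSymbol_apply φ _ _)
    (fun ξ ↦ mul_nonneg (by positivity) (mul_nonneg φ.nonneg (besselSymbol_nonneg _ _)))
    ((integrable_bump_mul_besselSymbol φ _).const_mul _) (y := t) (fun ξ hξ ↦ by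
      have hφξ : φ ξ ≠ 0 := fun h ↦ hξ (by rw [h, zero_mul, mul_zero])
      have hξR : ‖ξ‖ < 2 * (12 * r)⁻¹ := by
        by_contra hcon
        exact hφξ (φ.zero_of_le_dist (by rw [dist_zero_right]; exact not_lt.1 hcon))
      have : ‖ξ‖ * ‖t‖ ≤ 2 * (12 * r)⁻¹ * r := by gcongr
      have h6 : 2 * (12 * r)⁻¹ * r = 1 / 6 := by field_simp; norm_num
      rw [h6] at this
      nlinarith [Real.pi_pos])
  rw [integral_const_mul, ← hA] at hlow
  have hval : 1 / 2 * ((√A)⁻¹ * A) = √A / 2 := by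
    nth_rw 2 [← hsq]
    field_simp
  rw [hval] at hlow
  calc _ ≤ A / 4 := by linarith
    _ = (√A / 2) ^ 2 := by rw [div_pow, hsq]; norm_num
    _ ≤ _ := pow_le_pow_left₀ (by positivity) hlow 2

/-! ### Comparison of `1/ψ` with the logarithm -/

theorem psi_pos {t : ℝ} (ht : 0 < t) : 0 < psi t := by
  unfold psi
  split_ifs with h
  · refine one_div_pos.2 (Real.log_pos ?_)
    rw [one_lt_div ht]
    linarith [Real.add_one_lt_exp (one_ne_zero : (1 : ℝ) ≠ 0)]
  · exact ht

theorem inv_psi_le_log {t : ℝ} (ht : 0 < t) : (psi t)⁻¹ ≤ 3 * Real.log (1 + t⁻¹) := by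
  have htinv : 0 < t⁻¹ := inv_pos.2 ht
  unfold psi
  split_ifs with h
  · rw [one_div, inv_inv, Real.log_div (Real.exp_ne_zero 1) ht.ne', Real.log_exp]
    have h1 : Real.log t⁻¹ ≤ Real.log (1 + t⁻¹) := Real.log_le_log htinv (by linarith)
    -- Here `1/ψ(t) = 1 + log (1/t)`, and `1 ≤ 2 log 2` absorbs the constant term, giving the factor
    -- `3`.
    have h2 : Real.log 2 ≤ Real.log (1 + t⁻¹) :=
      Real.log_le_log two_pos (by linarith [(one_lt_inv₀ ht).2 h])
    rw [Real.log_inv] at h1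
    linarith [Real.log_two_gt_d9]
  · have h1 : t⁻¹ ≤ 1 := inv_le_one_of_one_le₀ (not_lt.1 h)
    have h2 := Real.one_sub_inv_le_log_of_pos (show 0 < 1 + t⁻¹ by linarith)
    have h3 : 1 - (1 + t⁻¹)⁻¹ = t⁻¹ / (1 + t⁻¹) := by
      field_simp
      ring
    have h4 : t⁻¹ / 2 ≤ t⁻¹ / (1 + t⁻¹) := by
      gcongr
      linarith
    linarith

/-- Bernoulli's inequality `(1 + x)^a ≤ 1 + a x`; it moves the factor `12^(-d)` out of the
logarithm. -/
theorem mul_log_one_add_le {a x : ℝ} (ha : 0 ≤ a) (ha1 : a ≤ 1) (hx : 0 ≤ x) :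
    a * Real.log (1 + x) ≤ Real.log (1 + a * x) := by
  rw [← Real.log_rpow (by linarith)]
  exact Real.log_le_log (by positivity) (rpow_one_add_le_one_add_mul_self (by linarith) ha ha1)

end Cwikel

theorem proposition6p2 (d : ℕ) (hd : 1 ≤ d) :
    ∃ c : ℝ, 0 < c ∧ ∀ f : ℝ → ℝ,
      Cwikel.MemMarcinkiewicz Cwikel.halfLine f →
      f =ᵐ[Cwikel.halfLine] Cwikel.rearrangement Cwikel.halfLine f →
      ENNReal.ofReal c * Cwikel.marcinkiewiczNorm Cwikel.halfLine f ≤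
        Cwikel.cwikelNorm (fun t : Cwikel.Rd d ↦ f (Cwikel.rd d t)) := by
  set ω : ℝ := (volume (Metric.ball (0 : Cwikel.Rd d) 1)).toReal with hω
  have hball : volume (Metric.ball (0 : Cwikel.Rd d) 1) ≠ ∞ := measure_ball_lt_top.ne
  have hωpos : 0 < ω := ENNReal.toReal_pos (Metric.measure_ball_pos _ _ one_pos).ne' hball
  -- The last `ω` comes from polar coordinates, `ω 8^(-d) / 4` from the capacity bound, `12^(-d)`
  -- from Bernoulli, and the remaining `1/3` from `inv_psi_le_log`.
  refine ⟨ω * (8 ^ d)⁻¹ * (12 ^ d)⁻¹ / 12 * ω, by positivity, fun f hf hfμ ↦ ?_⟩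
  have hnn : ∀ᵐ s ∂Cwikel.halfLine, 0 ≤ f s := by
    filter_upwards [hfμ] with s hs
    rw [hs]
    exact Real.sInf_nonneg fun r hr ↦ hr.1
  have hg : ∀ᵐ t : Cwikel.Rd d, 0 ≤ f (Cwikel.rd d t) :=
    (Cwikel.quasiMeasurePreserving_rd hd).ae hnn
  unfold Cwikel.marcinkiewiczNorm
  simp_rw [ENNReal.mul_iSup]
  refine iSup₂_le fun τ hτ ↦ ?_
  refine le_trans ?_ (Cwikel.lintegral_le_cwikelNorm hd hg hτ)
  have hfm : AEMeasurable (fun s ↦ ENNReal.ofReal (f s)) Cwikel.halfLine := hf.1.1.ennreal_ofReal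
  rw [Cwikel.lintegral_comp_rd hd hfm, ← hω]
  have hI : ∫⁻ s in Ioo 0 τ, ENNReal.ofReal (Cwikel.rearrangement Cwikel.halfLine f s) =
      ∫⁻ s in Ioo 0 τ, ENNReal.ofReal (f s) := by
    refine lintegral_congr_ae ?_
    filter_upwards [ae_restrict_of_ae_restrict_of_subset Ioo_subset_Ioi_self hfμ] with s hs
    rw [hs]
  have hψ := Cwikel.psi_pos hτ
  rw [hI, ENNReal.div_eq_inv_mul, ← ENNReal.ofReal_inv_of_pos hψ, ← mul_assoc, ← mul_assoc,
    ← ENNReal.ofReal_toReal hball, ← hω, ← ENNReal.ofReal_mul (by positivity),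
    ← ENNReal.ofReal_mul' hωpos.le]
  refine mul_le_mul_left (ENNReal.ofReal_le_ofReal ?_) _
  have h1 := Cwikel.inv_psi_le_log hτ
  have h2 := Cwikel.mul_log_one_add_le (a := (12 ^ d)⁻¹) (x := τ⁻¹) (by positivity)
    (inv_le_one_of_one_le₀ (one_le_pow₀ (by norm_num))) (by positivity)
  calc ω * (8 ^ d)⁻¹ * (12 ^ d)⁻¹ / 12 * ω * (Cwikel.psi τ)⁻¹
      ≤ ω * (8 ^ d)⁻¹ * (12 ^ d)⁻¹ / 12 * ω * (3 * Real.log (1 + τ⁻¹)) := by gcongr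
    _ = ω * ((8 ^ d)⁻¹ * ((12 ^ d)⁻¹ * Real.log (1 + τ⁻¹))) / 4 * ω := by ring
    _ ≤ _ := by gcongr
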